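/- Let $d\ge 1$, let $\omega\in\mathbb C$ be a primitive $d$-th root of unity, let $A$ be a $d$-dimensional quantum system with orthonormal basis $|0\rangle,\dots,|d-1\rangle$, and let $B$, $E$ be arbitrary finite-dimensional quantum systems. Let $Z=\sum_{z=0}^{d-1}\omega^z|z\rangle\langle z|$ and $X=\sum_{z=0}^{d-1}|z+1\rangle\langle z|$ (addition modulo $d$) be the generalized Pauli operators on $A$, with eigenvectors $|z\rangle$ and $|\tilde x\rangle=\frac1{\sqrt d}\sum_{z=0}^{d-1}\omega^{xz}|z\rangle$ respectively. For a state (density operator, pure or mixed) $\psi^{ABE}$ with reduced states $\psi^{AB}=\mathrm{Tr}_E\,\psi^{ABE}$ and $\psi^{AE}=\mathrm{Tr}_B\,\psi^{ABE}$, define the optimal guessing probabilities $$P(Z^A|E)_\psi=\max_{\Lambda}\mathrm{Tr}\Big[\sum_{z=0}^{d-1}\big(|z\rangle\langle z|^A\otimes\Lambda_z^E\big)\psi^{AE}\Big],\qquad P(X^A|B)_\psi=\max_{\Gamma}\mathrm{Tr}\Big[\sum_{x=0}^{d-1}\big(|\tilde x\rangle\langle\tilde x|^A\otimes\Gamma_x^B\big)\psi^{AB}\Big],$$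 where the maxima are over all POVMs with $d$ outcomes, i.e. all families of $d$ positive semidefinite operators on $E$ (respectively $B$) that sum to the identity. Then, for every tripartite state $\psi^{ABE}$, $$P(Z^A|E)_\psi+\Big(P(X^A|B)_\psi-\tfrac1d\Big)^2\le 1\qquad\text{and}\qquad P(X^A|B)_\psi+\Big(P(Z^A|E)_\psi-\tfrac1d\Big)^2\le 1.$$ -/

import Mathlib

open Matrix
open scoped Kronecker ComplexOrder

noncomputable section

namespace GuessingGame

/-- A quantum state (density operator) on the finite-dimensional space with basis `n`:
a positive semidefinite operator of unit trace. -/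
structure IsState {n : Type*} [Fintype n] (ρ : Matrix n n ℂ) : Prop where
  posSemidef : ρ.PosSemidef
  trace_eq_one : ρ.trace = 1

/-- A POVM with `d` outcomes: `d` positive semidefinite operators that sum to the identity. -/
structure IsPOVM {d : ℕ} {β : Type*} [Fintype β] [DecidableEq β]
    (Λ : Fin d → Matrix β β ℂ) : Prop where
  posSemidef : ∀ z, (Λ z).PosSemidef
  sum_eq_one : ∑ z, Λ z = 1

/-- The generalized Pauli operator `Z = ∑ z, ω ^ z |z⟩⟨z|`. -/
def pauliZ {d : ℕ} (ω : ℂ) : Matrix (Fin d) (Fin d) ℂ :=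
  Matrix.diagonal fun z => ω ^ (z : ℕ)

/-- The generalized Pauli operator `X = ∑ z, |z + 1⟩⟨z|` (addition modulo `d`). -/
def pauliX {d : ℕ} [NeZero d] : Matrix (Fin d) (Fin d) ℂ :=
  Matrix.of fun i z => if i = z + 1 then 1 else 0

/-- The fixed basis `|z⟩`, consisting of eigenvectors of `Z`. -/
def zKet {d : ℕ} (z : Fin d) : Fin d → ℂ := Pi.single z 1

/-- The conjugate basis `|x̃⟩ = d^(-1/2) ∑ z, ω ^ (x z) |z⟩`, consisting of eigenvectors
of `X`. -/
def xKet {d : ℕ} (ω : ℂ) (x : Fin d) : Fin d → ℂ :=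
  fun z => ω ^ ((x : ℕ) * (z : ℕ)) / (Real.sqrt d : ℂ)

/-- `|v⟩⟨v|`. -/
def ketbra {n : Type*} (v : n → ℂ) : Matrix n n ℂ := Matrix.vecMulVec v (star v)

/-- The probability `Tr[(∑ j, |v_j⟩⟨v_j|^A ⊗ Λ_j^B) ρ^{AB}]` that the outcome of the measurement
`Λ` on `B` coincides with the outcome of measuring `A` in the basis `v`. -/
def successProb {d : ℕ} {β : Type*} [Fintype β] (v : Fin d → Fin d → ℂ)
    (ρ : Matrix (Fin d × β) (Fin d × β) ℂ) (Λ : Fin d → Matrix β β ℂ) : ℝ :=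
  (((∑ j, ketbra (v j) ⊗ₖ Λ j) * ρ).trace).re

/-- The optimal probability of guessing, by a measurement on `B`, the outcome of measuring `A` in
the basis `v`: the maximum of the success probability over all POVMs on `B`. -/
def guessProb {d : ℕ} {β : Type*} [Fintype β] [DecidableEq β] (v : Fin d → Fin d → ℂ)
    (ρ : Matrix (Fin d × β) (Fin d × β) ℂ) : ℝ :=
  sSup {p | ∃ Λ : Fin d → Matrix β β ℂ, IsPOVM Λ ∧ p = successProb v ρ Λ}

/-- `P(Z^A|B)_ρ`. -/
def guessZ {d : ℕ} {β : Type*} [Fintype β] [DecidableEq β]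
    (ρ : Matrix (Fin d × β) (Fin d × β) ℂ) : ℝ :=
  guessProb zKet ρ

/-- `P(X^A|B)_ρ`. -/
def guessX {d : ℕ} {β : Type*} [Fintype β] [DecidableEq β] (ω : ℂ)
    (ρ : Matrix (Fin d × β) (Fin d × β) ℂ) : ℝ :=
  guessProb (xKet ω) ρ

/-- The reduced state `ψ^{AB} = Tr_E ψ^{ABE}`. -/
def marginalAB {α β ε : Type*} [Fintype ε] (ψ : Matrix (α × β × ε) (α × β × ε) ℂ) :
    Matrix (α × β) (α × β) ℂ :=
  Matrix.of fun i j => ∑ e, ψ (i.1, i.2, e) (j.1, j.2, e)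

/-- The reduced state `ψ^{AE} = Tr_B ψ^{ABE}`. -/
def marginalAE {α β ε : Type*} [Fintype β] (ψ : Matrix (α × β × ε) (α × β × ε) ℂ) :
    Matrix (α × ε) (α × ε) ℂ :=
  Matrix.of fun i j => ∑ b, ψ (i.1, b, i.2) (j.1, b, j.2)

theorem pauliZ_mulVec_zKet {d : ℕ} (ω : ℂ) (z : Fin d) :
    pauliZ ω *ᵥ zKet z = ω ^ (z : ℕ) • zKet z := by
  ext i
  by_cases h : i = z
  · subst h; simp [pauliZ, zKet, Matrix.mulVec_diagonal]
  · simp [pauliZ, zKet, Matrix.mulVec_diagonal, h]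

theorem pauliX_mulVec_xKet {d : ℕ} [NeZero d] (ω : ℂ) (hω : ω ^ d = 1) (x : Fin d) :
    pauliX *ᵥ xKet ω x = (ω⁻¹) ^ (x : ℕ) • xKet ω x := by
  have h0 : ω ≠ 0 := by
    rintro rfl
    simp [zero_pow (NeZero.ne d)] at hω
  have key : ∀ z : Fin d, ω ^ ((z + 1 : Fin d) : ℕ) = ω ^ (z : ℕ) * ω := by
    intro z
    rw [Fin.val_add, ← pow_succ, Fin.val_one', Nat.add_mod_mod]
    conv_rhs => rw [← Nat.mod_add_div ((z : ℕ) + 1) d, pow_add, pow_mul, hω, one_pow, mul_one]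
  ext i
  obtain ⟨z, rfl⟩ : ∃ z : Fin d, i = z + 1 := ⟨i - 1, by simp⟩
  have : (pauliX *ᵥ xKet ω x) (z + 1) = xKet ω x z := by
    simp [pauliX, Matrix.mulVec, dotProduct]
  rw [this]
  simp only [xKet, Pi.smul_apply, smul_eq_mul]
  rw [mul_comm (x : ℕ) ((z + 1 : Fin d) : ℕ), pow_mul ω ((z + 1 : Fin d) : ℕ), key, mul_pow,
    ← pow_mul, mul_comm (z : ℕ), inv_pow]
  field_simp

/-- The maximum in the definition of the guessing probability is attained. -/
theorem isGreatest_guessProb {d : ℕ} [NeZero d] {β : Type*} [Fintype β] [DecidableEq β]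
    (v : Fin d → Fin d → ℂ) (ρ : Matrix (Fin d × β) (Fin d × β) ℂ) :
    IsGreatest {p | ∃ Λ : Fin d → Matrix β β ℂ, IsPOVM Λ ∧ p = successProb v ρ Λ}
      (guessProb v ρ) := by
  have himg : {p | ∃ Λ : Fin d → Matrix β β ℂ, IsPOVM Λ ∧ p = successProb v ρ Λ}
      = successProb v ρ '' {Λ | IsPOVM Λ} := by
    ext p
    simp only [Set.mem_ofPred_eq, Set.mem_image, eq_comm]
  have hne : ({Λ : Fin d → Matrix β β ℂ | IsPOVM Λ}).Nonempty := by
    refine ⟨Pi.single (0 : Fin d) (1 : Matrix β β ℂ), fun z => ?_, by simp⟩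
    by_cases h : z = 0
    · subst h; simpa using Matrix.PosSemidef.one
    · simpa [h] using Matrix.PosSemidef.zero
  have hclosed : IsClosed {Λ : Fin d → Matrix β β ℂ | IsPOVM Λ} := by
    have : {Λ : Fin d → Matrix β β ℂ | IsPOVM Λ}
        = (⋂ z, ⋂ x : β → ℂ, {Λ : Fin d → Matrix β β ℂ | 0 ≤ star x ⬝ᵥ (Λ z *ᵥ x)}) ∩
          (⋂ z, {Λ : Fin d → Matrix β β ℂ | (Λ z)ᴴ = Λ z}) ∩ {Λ | ∑ z, Λ z = 1} := by
      ext Λ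
      simp only [Set.mem_ofPred_eq, Set.mem_inter_iff, Set.mem_iInter]
      constructor
      · intro h
        exact ⟨⟨fun z x => (h.posSemidef z).dotProduct_mulVec_nonneg x,
          fun z => (h.posSemidef z).isHermitian⟩, h.sum_eq_one⟩
      · rintro ⟨⟨h1, h2⟩, h3⟩
        exact ⟨fun z => Matrix.PosSemidef.of_dotProduct_mulVec_nonneg (h2 z) (h1 z), h3⟩
    rw [this]
    refine ((isClosed_iInter fun z => isClosed_iInter fun x => ?_).inter
      (isClosed_iInter fun z => ?_)).inter ?_
    · exact isClosed_le continuous_const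
        (continuous_const.dotProduct ((continuous_apply z).matrix_mulVec continuous_const))
    · exact isClosed_eq (continuous_apply z).matrix_conjTranspose (continuous_apply z)
    · exact isClosed_eq (continuous_finsetSum _ fun z _ => continuous_apply z) continuous_const
  have hsub : {Λ : Fin d → Matrix β β ℂ | IsPOVM Λ} ⊆
      Set.univ.pi fun _ => Set.univ.pi fun _ => Set.univ.pi fun _ =>
        Metric.closedBall (0 : ℂ) 1 := by
    intro Λ h z _ i _ j _
    have hdiag : ∀ i, 0 ≤ (Λ z i i).re ∧ (Λ z i i).re ≤ 1 ∧ (Λ z i i).im = 0 := by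
      intro i
      have hnn : ∀ w, 0 ≤ (Λ w i i).re ∧ 0 = (Λ w i i).im := fun w => by
        simpa using Complex.le_def.1 ((h.posSemidef w).diag_nonneg (i := i))
      have hs : ∑ w, (Λ w i i).re = 1 := by
        have := congrArg (fun M : Matrix β β ℂ => (M i i).re) h.sum_eq_one
        simpa [Matrix.sum_apply] using this
      exact ⟨(hnn z).1, hs ▸ Finset.single_le_sum (fun w _ => (hnn w).1) (Finset.mem_univ z),
        (hnn z).2.symm⟩
    have hdet := (Complex.le_def.1 ((h.posSemidef z).submatrix ![i, j]).det_nonneg).1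
    have hji : Λ z j i = star (Λ z i j) := ((h.posSemidef z).isHermitian.apply j i).symm
    simp only [Matrix.det_fin_two, Matrix.submatrix_apply, Matrix.cons_val_zero,
      Matrix.cons_val_one, hji, Complex.sub_re, Complex.mul_re, Complex.star_def, Complex.conj_re,
      Complex.conj_im, Complex.zero_re, (hdiag i).2.2] at hdet
    rw [mem_closedBall_zero_iff]
    have hsq : ‖Λ z i j‖ ^ 2 ≤ 1 := by
      rw [Complex.sq_norm, Complex.normSq_apply]
      nlinarith [hdiag i, hdiag j, mul_le_one₀ (hdiag i).2.1 (hdiag j).1 (hdiag j).2.1]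
    nlinarith [norm_nonneg (Λ z i j)]
  have hcomp : IsCompact {Λ : Fin d → Matrix β β ℂ | IsPOVM Λ} :=
    (isCompact_univ_pi fun _ => isCompact_univ_pi fun _ => isCompact_univ_pi fun _ =>
      isCompact_closedBall (0 : ℂ) 1).of_isClosed_subset hclosed hsub
  have hcont : Continuous (successProb (β := β) v ρ) := by
    unfold successProb
    refine Complex.continuous_re.comp ?_
    refine Continuous.matrix_trace ?_
    refine Continuous.matrix_mul ?_ continuous_const
    refine continuous_finsetSum _ fun j _ => ?_
    refine continuous_matrix fun a b => ?_
    simp only [Matrix.kroneckerMap_apply]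
    fun_prop
  have hI := hcomp.image hcont
  rw [guessProb, himg]
  exact hI.isGreatest_sSup (hne.image _)

end GuessingGame

end

/-!
Any two POVMs `Γ` on `B` and `Λ` on `E` already satisfy the inequality
`(q - 1/d)² ≤ 1 - p`, where `p` is the success probability of `Λ` for one of the two bases and `q`
that of `Γ` for the other; the theorem follows by inserting the optimal POVMs.

Let `v` be the basis guessed from `E` and `w` the one guessed from `B`. Factor `Λ k = (ℓ k)ᴴ * ℓ k`,
so that the `ℓ k` are the components of an isometry that writes the outcome of `Λ` into a register,
and let `E k = |v k⟩⟨v k|`. Then `p` is the weight of the subspace on which `A` agrees with the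
register. The test operator `T = ∑ x, |w x⟩⟨w x| ⊗ Γ x` commutes with the isometry, and since `v`
and `w` are mutually unbiased, `E k * T * E k = (1/d) • E k`: a state on which the guess of `v` is
always right passes the test with probability exactly `1/d`. The deviation of `q` from `1/d`
therefore comes from the part of the state of weight `1 - p` off that subspace and from the cross
terms. The cross terms are bounded by the Cauchy-Schwarz inequality for `T` and for `1 - T`
(`sq_cross_le`); the two bounds combine to `(q - 1/d)² ≤ 1 - p` (`sq_le_of_sandwich`,
`sq_sub_le_one_sub`), which is the statement that two pure states with squared overlap `p` are
distinguished with advantage at most `√(1 - p)`. The argument is symmetric in the two mutually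
unbiased bases, which gives both inequalities.
-/

namespace GuessingGame

/-! ### A two-dimensional estimate and its version for positive functionals -/

/-- For `U = e * u` and `W² = 4 * p * e * r²`, the hypotheses `h₁` and `h₂` say that the
real symmetric matrix with diagonal `t, u` and off-diagonal entry `r` has its eigenvalues in
`[0, 1]`. The conclusion bounds the change of its quadratic form between the first basis vector
and `(√p, √e)`. -/
theorem sq_le_of_sandwich {p e t U W : ℝ} (hp : 0 ≤ p) (hpe : p + e = 1)
    (ht : 0 ≤ t) (ht' : t ≤ 1) (hU : 0 ≤ U) (hU' : U ≤ e)
    (h₁ : W ^ 2 ≤ 4 * (t * p) * U) (h₂ : W ^ 2 ≤ 4 * ((1 - t) * p) * (e - U)) :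
    (U - t * e + W) ^ 2 ≤ e := by
  have he : 0 ≤ e := hU.trans hU'
  have hte : t * e ≤ e := mul_le_of_le_one_left he ht'
  have hte0 : 0 ≤ t * e := mul_nonneg ht he
  -- For `p = 0` or `e = 0` the cross term `W` vanishes; otherwise one may divide by `p * e`.
  rcases hp.eq_or_lt with rfl | hp
  · have hW : W = 0 := by nlinarith
    subst hW
    obtain rfl : e = 1 := by linarith
    nlinarith
  rcases he.eq_or_lt with rfl | he
  · obtain rfl : U = 0 := le_antisymm hU' hU
    have hW : W = 0 := by nlinarith
    simp [hW]
  -- `h₁` suffices when the trace `t + U / e` of the matrix is at most `1`, and `h₂` otherwise.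
  have hsum : p * (U - t * e) ^ 2 + e * W ^ 2 ≤ p * e ^ 2 := by
    rcases le_total (U + t * e) e with h | h
    · have hsq : (U + t * e) ^ 2 ≤ e ^ 2 := pow_le_pow_left₀ (by linarith) h 2
      nlinarith [mul_le_mul_of_nonneg_left h₁ he.le, mul_le_mul_of_nonneg_left hsq hp.le]
    · have hsq : (2 * e - U - t * e) ^ 2 ≤ e ^ 2 :=
        pow_le_pow_left₀ (by linarith) (by linarith) 2
      nlinarith [mul_le_mul_of_nonneg_left h₂ he.le, mul_le_mul_of_nonneg_left hsq hp.le]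
  have hcs : p * e * (U - t * e + W) ^ 2 ≤ p * (U - t * e) ^ 2 + e * W ^ 2 := by
    have hid : (p * (U - t * e) ^ 2 + e * W ^ 2) * (p + e) - p * e * (U - t * e + W) ^ 2
        = (p * (U - t * e) - e * W) ^ 2 := by ring
    rw [hpe, mul_one] at hid
    linarith [sq_nonneg (p * (U - t * e) - e * W)]
  have hmul : (p * e) * (U - t * e + W) ^ 2 ≤ (p * e) * e := by linarith [sq_nonneg e]
  exact le_of_mul_le_mul_left hmul (mul_pos hp he)

section PositiveFunctional

variable {n ι : Type*} [Fintype n] [DecidableEq n] [Fintype ι]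

/-- Cauchy-Schwarz inequality for the form `(X, Y) ↦ ∑ k, F ((X k)ᴴ * T * Y k)` given by a positive
functional `F` and a positive semidefinite `T`. -/
theorem sq_cross_le (F : Matrix n n ℂ →ₗ[ℝ] ℝ) (hF : ∀ M : Matrix n n ℂ, M.PosSemidef → 0 ≤ F M)
    {T : Matrix n n ℂ} (hT : T.PosSemidef) (P Q : ι → Matrix n n ℂ) :
    F (∑ k, ((P k)ᴴ * T * Q k + (Q k)ᴴ * T * P k)) ^ 2
      ≤ 4 * F (∑ k, (P k)ᴴ * T * P k) * F (∑ k, (Q k)ᴴ * T * Q k) := by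
  have key : ∀ s : ℝ, 0 ≤ F (∑ k, (Q k)ᴴ * T * Q k) * (s * s)
      + F (∑ k, ((P k)ᴴ * T * Q k + (Q k)ᴴ * T * P k)) * s + F (∑ k, (P k)ᴴ * T * P k) := by
    intro s
    have h := hF (∑ k, (P k + s • Q k)ᴴ * T * (P k + s • Q k))
      (Matrix.posSemidef_sum _ fun k _ => hT.conjTranspose_mul_mul_same _)
    have hexp : ∑ k, (P k + s • Q k)ᴴ * T * (P k + s • Q k)
        = (s * s) • ∑ k, (Q k)ᴴ * T * Q k
          + s • ∑ k, ((P k)ᴴ * T * Q k + (Q k)ᴴ * T * P k) + ∑ k, (P k)ᴴ * T * P k := by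
      rw [Finset.smul_sum, Finset.smul_sum, ← Finset.sum_add_distrib, ← Finset.sum_add_distrib]
      refine Finset.sum_congr rfl fun k _ => ?_
      simp only [Matrix.conjTranspose_add, Matrix.conjTranspose_smul, star_trivial, add_mul,
        mul_add, Matrix.smul_mul, Matrix.mul_smul, smul_add, smul_smul]
      abel
    rw [hexp, map_add, map_add, map_smul, map_smul, smul_eq_mul, smul_eq_mul] at h
    linarith
  have := discrim_le_zero key
  rw [discrim] at this
  linarith

/-- Gentle measurement in the Heisenberg picture. The operators `L k` are the components of an
isometry commuting with `T`, and the `E k` are projections compressing `T` to a multiple `t` of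
themselves. Then the value of the state `F` on `T` is within `√(1 - p)` of `t`, where `p` is the
probability that the projection succeeds. -/
theorem sq_sub_le_one_sub (F : Matrix n n ℂ →ₗ[ℝ] ℝ)
    (hF : ∀ M : Matrix n n ℂ, M.PosSemidef → 0 ≤ F M) (hF1 : F 1 = 1)
    {T : Matrix n n ℂ} (hT : T.PosSemidef) (hT' : (1 - T).PosSemidef)
    {t : ℝ} (ht : 0 ≤ t) (ht' : t ≤ 1) {L E : ι → Matrix n n ℂ}
    (hL : ∑ k, (L k)ᴴ * L k = 1) (hLT : ∀ k, Commute T (L k))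
    (hE : ∀ k, (E k)ᴴ = E k) (hEE : ∀ k, E k * E k = E k) (hETE : ∀ k, E k * T * E k = t • E k) :
    (F T - t) ^ 2 ≤ 1 - F (∑ k, (L k)ᴴ * E k * L k) := by
  -- `P + Q` splits the isometry into its part in the range of the projection and the rest.
  obtain ⟨P, hP⟩ : ∃ P : ι → Matrix n n ℂ, ∀ k, P k = E k * L k := ⟨_, fun _ => rfl⟩
  obtain ⟨Q, hQ⟩ : ∃ Q : ι → Matrix n n ℂ, ∀ k, Q k = (1 - E k) * L k := ⟨_, fun _ => rfl⟩
  have hPP : ∀ k, (P k)ᴴ * P k = (L k)ᴴ * E k * L k := fun k => by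
    simp only [hP, Matrix.conjTranspose_mul, hE]
    rw [mul_assoc, ← mul_assoc (E k), hEE, ← mul_assoc]
  have hPTP : ∀ k, (P k)ᴴ * T * P k = t • ((P k)ᴴ * P k) := fun k => by
    rw [hPP]
    simp only [hP, Matrix.conjTranspose_mul, hE]
    calc (L k)ᴴ * E k * T * (E k * L k) = (L k)ᴴ * (E k * T * E k) * L k := by
          simp only [mul_assoc]
      _ = _ := by rw [hETE, Matrix.mul_smul, Matrix.smul_mul]
  have hPQ : ∀ k, (P k)ᴴ * Q k = 0 := fun k => by
    simp only [hP, hQ, Matrix.conjTranspose_mul, hE]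
    calc (L k)ᴴ * E k * ((1 - E k) * L k) = (L k)ᴴ * (E k - E k * E k) * L k := by noncomm_ring
      _ = 0 := by rw [hEE]; simp
  have hQP : ∀ k, (Q k)ᴴ * P k = 0 := fun k => by
    simpa using congrArg Matrix.conjTranspose (hPQ k)
  have hPaddQ : ∀ k, P k + Q k = L k := fun k => by simp only [hP, hQ]; noncomm_ring
  have hone : ∑ k, (P k)ᴴ * P k + ∑ k, (Q k)ᴴ * Q k = 1 := by
    rw [← hL, ← Finset.sum_add_distrib]
    refine Finset.sum_congr rfl fun k _ => ?_
    rw [← hPaddQ k, Matrix.conjTranspose_add, add_mul, mul_add, mul_add, hPQ, hQP]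
    simp
  have hTsum : ∑ k, (P k)ᴴ * T * P k + ∑ k, ((P k)ᴴ * T * Q k + (Q k)ᴴ * T * P k)
      + ∑ k, (Q k)ᴴ * T * Q k = T := by
    conv_rhs => rw [← one_mul T, ← hL, Finset.sum_mul]
    rw [← Finset.sum_add_distrib, ← Finset.sum_add_distrib]
    refine Finset.sum_congr rfl fun k _ => ?_
    rw [mul_assoc (L k)ᴴ, ← (hLT k).eq, ← mul_assoc, ← hPaddQ k, Matrix.conjTranspose_add]
    noncomm_ring
  have hcompl : ∀ X Y : Matrix n n ℂ, Xᴴ * (1 - T) * Y = Xᴴ * Y - Xᴴ * T * Y := fun X Y => by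
    noncomm_ring
  have h₁ := sq_cross_le F hF hT P Q
  have h₂ := sq_cross_le F hF hT' P Q
  have hU := hF (∑ k, (Q k)ᴴ * T * Q k)
    (Matrix.posSemidef_sum _ fun k _ => hT.conjTranspose_mul_mul_same _)
  have hU' := hF (∑ k, (Q k)ᴴ * (1 - T) * Q k)
    (Matrix.posSemidef_sum _ fun k _ => hT'.conjTranspose_mul_mul_same _)
  have hp := hF (∑ k, (P k)ᴴ * P k)
    (Matrix.posSemidef_sum _ fun k _ => Matrix.posSemidef_conjTranspose_mul_self _)
  have hA : F (∑ k, (P k)ᴴ * T * P k) = t * F (∑ k, (P k)ᴴ * P k) := by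
    simp only [hPTP, ← Finset.smul_sum, map_smul, smul_eq_mul]
  have hW' : ∑ k, ((P k)ᴴ * (1 - T) * Q k + (Q k)ᴴ * (1 - T) * P k)
      = - ∑ k, ((P k)ᴴ * T * Q k + (Q k)ᴴ * T * P k) := by
    rw [← Finset.sum_neg_distrib]
    refine Finset.sum_congr rfl fun k _ => ?_
    rw [hcompl, hcompl, hPQ, hQP]
    abel
  rw [hW', map_neg, neg_sq] at h₂
  simp only [hcompl, Finset.sum_sub_distrib, map_sub] at h₂ hU'
  rw [hA] at h₁ h₂
  have h1 := congrArg F hone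
  rw [map_add, hF1] at h1
  have hq := congrArg F hTsum
  rw [map_add, map_add, hA] at hq
  simp only [← hPP]
  have := sq_le_of_sandwich (t := t) hp h1 ht ht' hU (by linarith) h₁ (by linarith)
  have e1 : F T - t = F (∑ k, (Q k)ᴴ * T * Q k) - t * F (∑ k, (Q k)ᴴ * Q k)
      + F (∑ k, ((P k)ᴴ * T * Q k + (Q k)ᴴ * T * P k)) := by
    linear_combination -hq + t * h1
  rw [e1]
  linarith

end PositiveFunctional

/-! ### Rank-one operators and the functional of a state -/

theorem ketbra_mul_ketbra {n : Type*} [Fintype n] (v w : n → ℂ) :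
    ketbra v * ketbra w = (star v ⬝ᵥ w) • Matrix.vecMulVec v (star w) := by
  simp [ketbra, Matrix.vecMulVec_mul_vecMulVec]

theorem posSemidef_ketbra {n : Type*} [Fintype n] (v : n → ℂ) : (ketbra v).PosSemidef :=
  Matrix.posSemidef_vecMulVec_self_star v

theorem ketbra_mul_ketbra_mul_ketbra {n : Type*} [Fintype n] (v w : n → ℂ) :
    ketbra v * ketbra w * ketbra v = ((star v ⬝ᵥ w) * (star w ⬝ᵥ v)) • ketbra v := by
  rw [ketbra_mul_ketbra, Matrix.smul_mul, ketbra, Matrix.vecMulVec_mul_vecMulVec,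
    Matrix.vecMulVec_smul, smul_smul]

open scoped MatrixOrder in
theorem exists_eq_conjTranspose_mul_self {n : Type*} [Fintype n] [DecidableEq n]
    {M : Matrix n n ℂ} (hM : M.PosSemidef) : ∃ C : Matrix n n ℂ, M = Cᴴ * C :=
  CStarAlgebra.nonneg_iff_eq_star_mul_self.1 hM.nonneg

section Functional

variable {n : Type*} [Fintype n]

/-- The real part of the expectation value `Tr (M ρ)`, as a real-linear functional of `M`. -/
def reTrace (ρ : Matrix n n ℂ) : Matrix n n ℂ →ₗ[ℝ] ℝ where
  toFun M := ((M * ρ).trace).re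
  map_add' M N := by simp [add_mul]
  map_smul' r M := by simp

theorem reTrace_nonneg {ρ M : Matrix n n ℂ} (hρ : ρ.PosSemidef) (hM : M.PosSemidef) :
    0 ≤ reTrace ρ M := by
  classical
  obtain ⟨C, rfl⟩ := exists_eq_conjTranspose_mul_self hρ
  have h := (hM.mul_mul_conjTranspose_same C).trace_nonneg
  have hc : (M * (Cᴴ * C)).trace = (C * M * Cᴴ).trace := by
    rw [← mul_assoc, Matrix.trace_mul_comm, ← mul_assoc]
  change 0 ≤ ((M * (Cᴴ * C)).trace).re
  rw [hc]
  exact (Complex.le_def.1 h).1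

end Functional

/-! ### The trade-off for fixed commuting measurements -/

/-- The trade-off for two fixed POVMs `Γ` and `k ↦ (ℓ k)ᴴ * ℓ k` on the same memory, with the
factors `ℓ k` commuting with `Γ`. For measurements on separate systems `B` and `E` the memory is
the joint system. -/
theorem successProb_add_sq_le {d : ℕ} [NeZero d] {μ : Type*} [Fintype μ] [DecidableEq μ]
    {v w : Fin d → Fin d → ℂ} (hv : ∀ k, star (v k) ⬝ᵥ v k = 1)
    (hw : ∑ x, ketbra (w x) = 1)
    (hvw : ∀ k x, (star (v k) ⬝ᵥ w x) * (star (w x) ⬝ᵥ v k) = 1 / (d : ℂ))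
    {ρ : Matrix (Fin d × μ) (Fin d × μ) ℂ} (hρ : IsState ρ)
    {Γ ℓ : Fin d → Matrix μ μ ℂ} (hΓ : IsPOVM Γ) (hℓ : ∑ k, (ℓ k)ᴴ * ℓ k = 1)
    (hcomm : ∀ x k, Commute (Γ x) (ℓ k)) :
    successProb v ρ (fun k => (ℓ k)ᴴ * ℓ k) + (successProb w ρ Γ - 1 / (d : ℝ)) ^ 2 ≤ 1 := by
  have hd : (1 : ℝ) ≤ d := by exact_mod_cast NeZero.one_le
  have hT : (∑ x, ketbra (w x) ⊗ₖ Γ x).PosSemidef :=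
    Matrix.posSemidef_sum _ fun x _ => (posSemidef_ketbra _).kronecker (hΓ.posSemidef x)
  have hΓ' : ∀ x, (1 - Γ x).PosSemidef := fun x => by
    rw [← hΓ.sum_eq_one, ← Finset.sum_erase_eq_sub (Finset.mem_univ x)]
    exact Matrix.posSemidef_sum _ fun y _ => hΓ.posSemidef y
  have hT' : (1 - ∑ x, ketbra (w x) ⊗ₖ Γ x).PosSemidef := by
    have : 1 - ∑ x, ketbra (w x) ⊗ₖ Γ x = ∑ x, ketbra (w x) ⊗ₖ (1 - Γ x) := by
      rw [← Matrix.one_kronecker_one, ← hw]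
      ext ⟨i, a⟩ ⟨j, b⟩
      simp [Matrix.sum_apply, Finset.sum_mul, mul_sub]
    rw [this]
    exact Matrix.posSemidef_sum _ fun x _ => (posSemidef_ketbra _).kronecker (hΓ' x)
  have hF1 : reTrace ρ 1 = 1 := by
    change ((1 * ρ).trace).re = 1
    rw [one_mul, hρ.trace_eq_one, Complex.one_re]
  have hkk : ∀ k, ketbra (v k) * ketbra (v k) = ketbra (v k) := fun k => by
    rw [ketbra_mul_ketbra, hv, one_smul, ketbra]
  have key := sq_sub_le_one_sub (reTrace ρ) (fun M => reTrace_nonneg hρ.posSemidef) hF1 hT hT'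
    (t := 1 / (d : ℝ)) (by positivity) (by rw [div_le_one (by linarith)]; exact hd)
    (L := fun k => (1 : Matrix (Fin d) (Fin d) ℂ) ⊗ₖ ℓ k)
    (E := fun k => ketbra (v k) ⊗ₖ (1 : Matrix μ μ ℂ))
    (by
      have : ∀ k, ((1 : Matrix (Fin d) (Fin d) ℂ) ⊗ₖ ℓ k)ᴴ * ((1 : Matrix (Fin d) (Fin d) ℂ) ⊗ₖ ℓ k)
          = (1 : Matrix (Fin d) (Fin d) ℂ) ⊗ₖ ((ℓ k)ᴴ * ℓ k) := fun k => by
        rw [Matrix.conjTranspose_kronecker, ← Matrix.mul_kronecker_mul]; simp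
      simp only [this]
      rw [← Matrix.one_kronecker_one, ← hℓ]
      ext ⟨i, a⟩ ⟨j, b⟩
      simp [Matrix.sum_apply, Finset.mul_sum])
    (fun k => by
      refine Commute.sum_left _ _ _ fun x _ => ?_
      rw [commute_iff_eq, ← Matrix.mul_kronecker_mul, ← Matrix.mul_kronecker_mul,
        (hcomm x k).eq, one_mul, mul_one])
    (fun k => by
      rw [Matrix.conjTranspose_kronecker, (posSemidef_ketbra _).isHermitian.eq,
        Matrix.conjTranspose_one])
    (fun k => by rw [← Matrix.mul_kronecker_mul, hkk, one_mul])
    (fun k => by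
      have : ∀ x, ketbra (v k) ⊗ₖ (1 : Matrix μ μ ℂ) * (ketbra (w x) ⊗ₖ Γ x)
          * (ketbra (v k) ⊗ₖ (1 : Matrix μ μ ℂ)) = ((1 / (d : ℂ)) • ketbra (v k)) ⊗ₖ Γ x :=
        fun x => by
          rw [← Matrix.mul_kronecker_mul, ← Matrix.mul_kronecker_mul,
            ketbra_mul_ketbra_mul_ketbra, hvw, one_mul, mul_one]
      rw [Finset.mul_sum, Finset.sum_mul]
      simp only [this]
      rw [← hΓ.sum_eq_one]
      ext ⟨i, a⟩ ⟨j, b⟩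
      simp [Matrix.sum_apply, Finset.mul_sum, mul_assoc])
  have hL : ∀ k, ((1 : Matrix (Fin d) (Fin d) ℂ) ⊗ₖ ℓ k)ᴴ * (ketbra (v k) ⊗ₖ (1 : Matrix μ μ ℂ))
      * ((1 : Matrix (Fin d) (Fin d) ℂ) ⊗ₖ ℓ k) = ketbra (v k) ⊗ₖ ((ℓ k)ᴴ * ℓ k) := fun k => by
    rw [Matrix.conjTranspose_kronecker, ← Matrix.mul_kronecker_mul, ← Matrix.mul_kronecker_mul]
    simp
  simp only [hL] at key
  change (successProb w ρ Γ - 1 / (d : ℝ)) ^ 2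
    ≤ 1 - successProb v ρ (fun k => (ℓ k)ᴴ * ℓ k) at key
  linarith

/-! ### Measurements on one part of a joint system -/

section Marginals

variable {d : ℕ} {β ε : Type*} [Fintype β] [Fintype ε]

theorem successProb_marginalAB [DecidableEq ε] (v : Fin d → Fin d → ℂ)
    (ψ : Matrix (Fin d × β × ε) (Fin d × β × ε) ℂ) (Γ : Fin d → Matrix β β ℂ) :
    successProb v (marginalAB ψ) Γ
      = successProb v ψ (fun x => Γ x ⊗ₖ (1 : Matrix ε ε ℂ)) := by
  unfold successProb
  congr 1
  simp only [Finset.sum_mul, Matrix.trace_sum]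
  refine Finset.sum_congr rfl fun x _ => ?_
  simp only [Matrix.trace, Matrix.diag, Matrix.mul_apply, Fintype.sum_prod_type, marginalAB,
    Matrix.of_apply, Matrix.kroneckerMap_apply, Matrix.one_apply, mul_ite, ite_mul, mul_one,
    mul_zero, zero_mul, Finset.sum_ite_eq, Finset.mem_univ, if_true, Finset.mul_sum]
  exact Finset.sum_congr rfl fun i _ => Finset.sum_congr rfl fun a _ =>
    (Finset.sum_congr rfl fun j _ => Finset.sum_comm).trans Finset.sum_comm

theorem successProb_marginalAE [DecidableEq β] (v : Fin d → Fin d → ℂ)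
    (ψ : Matrix (Fin d × β × ε) (Fin d × β × ε) ℂ) (Λ : Fin d → Matrix ε ε ℂ) :
    successProb v (marginalAE ψ) Λ
      = successProb v ψ (fun z => (1 : Matrix β β ℂ) ⊗ₖ Λ z) := by
  unfold successProb
  congr 1
  simp only [Finset.sum_mul, Matrix.trace_sum]
  refine Finset.sum_congr rfl fun x _ => ?_
  simp only [Matrix.trace, Matrix.diag, Matrix.mul_apply, Fintype.sum_prod_type, marginalAE,
    Matrix.of_apply, Matrix.kroneckerMap_apply, Matrix.one_apply, mul_ite, ite_mul,
    mul_zero, zero_mul, one_mul, Finset.sum_ite_eq, Finset.mem_univ, if_true, Finset.mul_sum,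
    Finset.sum_ite_irrel, Finset.sum_const_zero]
  refine Finset.sum_congr rfl fun i _ => ?_
  rw [Finset.sum_comm (s := (Finset.univ : Finset β)) (t := (Finset.univ : Finset ε))]
  refine Finset.sum_congr rfl fun a _ => ?_
  exact (Finset.sum_congr rfl fun j _ => Finset.sum_comm).trans Finset.sum_comm

end Marginals

section POVM

variable {d : ℕ} {β ε : Type*} [Fintype β] [DecidableEq β] [Fintype ε] [DecidableEq ε]

theorem IsPOVM.kronecker_one {Γ : Fin d → Matrix β β ℂ} (h : IsPOVM Γ) :
    IsPOVM fun x => Γ x ⊗ₖ (1 : Matrix ε ε ℂ) where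
  posSemidef x := (h.posSemidef x).kronecker .one
  sum_eq_one := by
    rw [← Matrix.one_kronecker_one, ← h.sum_eq_one]
    ext ⟨i, a⟩ ⟨j, b⟩
    simp [Matrix.sum_apply, Finset.sum_mul]

theorem IsPOVM.one_kronecker {Λ : Fin d → Matrix ε ε ℂ} (h : IsPOVM Λ) :
    IsPOVM fun x => (1 : Matrix β β ℂ) ⊗ₖ Λ x where
  posSemidef x := Matrix.PosSemidef.one.kronecker (h.posSemidef x)
  sum_eq_one := by
    rw [← Matrix.one_kronecker_one, ← h.sum_eq_one]
    ext ⟨i, a⟩ ⟨j, b⟩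
    simp [Matrix.sum_apply, Finset.mul_sum]

theorem IsPOVM.exists_conjTranspose_mul_self {Λ : Fin d → Matrix β β ℂ} (h : IsPOVM Λ) :
    ∃ ℓ : Fin d → Matrix β β ℂ, Λ = fun k => (ℓ k)ᴴ * ℓ k := by
  choose ℓ hℓ using fun k => exists_eq_conjTranspose_mul_self (h.posSemidef k)
  exact ⟨ℓ, funext hℓ⟩

end POVM

/-! ### The two mutually unbiased bases -/

section Bases

variable {d : ℕ}

theorem star_zKet_dotProduct (k : Fin d) (u : Fin d → ℂ) : star (zKet k) ⬝ᵥ u = u k := by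
  simp [zKet, Pi.star_single]

theorem sum_ketbra_zKet : ∑ z : Fin d, ketbra (zKet z) = 1 := by
  ext i j
  simp [ketbra, zKet, Matrix.sum_apply, Matrix.vecMulVec_apply, Pi.single_apply, Matrix.one_apply]

theorem star_dotProduct_zKet (k : Fin d) (u : Fin d → ℂ) : star u ⬝ᵥ zKet k = star (u k) := by
  simp [zKet]

theorem xKet_mul_star (ω : ℂ) (x z z' : Fin d) :
    xKet ω x z * star (xKet ω x z') = (ω ^ (z : ℕ) * star ω ^ (z' : ℕ)) ^ (x : ℕ) / d := by
  have hs : ((Real.sqrt d : ℝ) : ℂ) * (Real.sqrt d : ℝ) = d := by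
    rw [← Complex.ofReal_mul, Real.mul_self_sqrt (Nat.cast_nonneg d), Complex.ofReal_natCast]
  simp only [xKet, star_div₀, star_pow]
  have hs' : star ((Real.sqrt d : ℝ) : ℂ) = (Real.sqrt d : ℝ) := Complex.conj_ofReal _
  rw [hs', div_mul_div_comm, hs, mul_pow,
    ← pow_mul, ← pow_mul, mul_comm (x : ℕ) z, mul_comm (x : ℕ) z']

variable [NeZero d] {ω : ℂ}

theorem star_mul_self_of_isPrimitiveRoot (hω : IsPrimitiveRoot ω d) : star ω * ω = 1 := by
  have h := hω.norm'_eq_one (NeZero.ne d)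
  rw [Complex.star_def, mul_comm, Complex.mul_conj, Complex.normSq_eq_norm_sq, h]
  simp

theorem xKet_mul_star_self (hω : IsPrimitiveRoot ω d) (x z : Fin d) :
    xKet ω x z * star (xKet ω x z) = 1 / d := by
  rw [xKet_mul_star, ← mul_pow, mul_comm ω, star_mul_self_of_isPrimitiveRoot hω]
  simp

theorem star_xKet_dotProduct_self (hω : IsPrimitiveRoot ω d) (x : Fin d) :
    star (xKet ω x) ⬝ᵥ xKet ω x = 1 := by
  rw [dotProduct_comm]
  simp only [dotProduct, Pi.star_apply, xKet_mul_star_self hω]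
  simp [NeZero.ne d]

theorem sum_ketbra_xKet (hω : IsPrimitiveRoot ω d) : ∑ x : Fin d, ketbra (xKet ω x) = 1 := by
  ext z z'
  simp only [Matrix.sum_apply, ketbra, Matrix.vecMulVec_apply, Pi.star_apply]
  rcases eq_or_ne z z' with rfl | hne
  · rw [Finset.sum_congr rfl fun x _ => xKet_mul_star_self hω x z]
    simp [NeZero.ne d]
  · simp only [xKet_mul_star]
    rw [← Finset.sum_div, Matrix.one_apply_ne hne,
      Fin.sum_univ_eq_sum_range (fun x => (ω ^ (z : ℕ) * star ω ^ (z' : ℕ)) ^ x) d]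
    -- The entry is a geometric sum over a nontrivial `d`-th root of unity.
    set ζ := ω ^ (z : ℕ) * star ω ^ (z' : ℕ) with hζ
    have hζd : ζ ^ d = 1 := by
      rw [hζ, mul_pow, pow_right_comm, hω.pow_eq_one, pow_right_comm, ← star_pow ω d,
        hω.pow_eq_one]
      simp
    have hζ1 : ζ ≠ 1 := by
      intro h
      have h' : ω ^ (z : ℕ) = ω ^ (z' : ℕ) := by
        calc ω ^ (z : ℕ) = ω ^ (z : ℕ) * (star ω * ω) ^ (z' : ℕ) := by
              rw [star_mul_self_of_isPrimitiveRoot hω, one_pow, mul_one]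
          _ = ζ * ω ^ (z' : ℕ) := by rw [mul_pow, hζ, mul_assoc]
          _ = _ := by rw [h, one_mul]
      exact hne (Fin.ext (hω.pow_inj z.2 z'.2 h'))
    rw [geom_sum_eq hζ1, hζd]
    simp

end Bases

end GuessingGame

theorem theorem3 {d : ℕ} {β ε : Type*} [Fintype β] [DecidableEq β] [Fintype ε] [DecidableEq ε]
    (ω : ℂ) (hω : IsPrimitiveRoot ω d)
    (ψ : Matrix (Fin d × β × ε) (Fin d × β × ε) ℂ) (hψ : GuessingGame.IsState ψ) :
    GuessingGame.guessZ (GuessingGame.marginalAE ψ)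
        + (GuessingGame.guessX ω (GuessingGame.marginalAB ψ) - 1 / (d : ℝ)) ^ 2 ≤ 1 ∧
      GuessingGame.guessX ω (GuessingGame.marginalAB ψ)
        + (GuessingGame.guessZ (GuessingGame.marginalAE ψ) - 1 / (d : ℝ)) ^ 2 ≤ 1 := by
  open GuessingGame in
  -- A state on the empty system `d = 0` would have trace `0`.
  have : NeZero d := ⟨by
    rintro rfl
    simpa [Matrix.trace] using hψ.trace_eq_one⟩
  obtain ⟨Λ, hΛ, hZ⟩ := (isGreatest_guessProb zKet (marginalAE ψ)).1
  obtain ⟨Γ, hΓ, hX⟩ := (isGreatest_guessProb (xKet ω) (marginalAB ψ)).1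
  rw [guessZ, guessX, hZ, hX, successProb_marginalAE, successProb_marginalAB]
  obtain ⟨l, rfl⟩ := hΛ.exists_conjTranspose_mul_self
  obtain ⟨g, rfl⟩ := hΓ.exists_conjTranspose_mul_self
  have hl : (fun k => (1 : Matrix β β ℂ) ⊗ₖ ((l k)ᴴ * l k))
      = fun k => ((1 : Matrix β β ℂ) ⊗ₖ l k)ᴴ * ((1 : Matrix β β ℂ) ⊗ₖ l k) := by
    funext k
    rw [Matrix.conjTranspose_kronecker, ← Matrix.mul_kronecker_mul]; simp
  have hg : (fun k => ((g k)ᴴ * g k) ⊗ₖ (1 : Matrix ε ε ℂ))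
      = fun k => (g k ⊗ₖ (1 : Matrix ε ε ℂ))ᴴ * (g k ⊗ₖ (1 : Matrix ε ε ℂ)) := by
    funext k
    rw [Matrix.conjTranspose_kronecker, ← Matrix.mul_kronecker_mul]; simp
  -- Measurements on `B` and on `E` commute.
  have hcomm : ∀ (M : Matrix β β ℂ) (N : Matrix ε ε ℂ), Commute (M ⊗ₖ 1) (1 ⊗ₖ N) := fun M N => by
    rw [commute_iff_eq, ← Matrix.mul_kronecker_mul, ← Matrix.mul_kronecker_mul]; simp
  constructor
  · rw [hl]
    refine successProb_add_sq_le (fun k => ?_) (sum_ketbra_xKet hω) (fun k x => ?_) hψ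
      hΓ.kronecker_one ?_ (fun x k => hcomm _ _)
    · simp [zKet]
    · rw [star_zKet_dotProduct, star_dotProduct_zKet, xKet_mul_star_self hω]
    · have := (hΛ.one_kronecker (β := β)).sum_eq_one
      simpa only [hl] using this
  · rw [hg]
    refine successProb_add_sq_le (star_xKet_dotProduct_self hω) sum_ketbra_zKet (fun k x => ?_) hψ
      hΛ.one_kronecker ?_ (fun x k => (hcomm _ _).symm)
    · rw [star_zKet_dotProduct, star_dotProduct_zKet, mul_comm, xKet_mul_star_self hω]
    · have := (hΓ.kronecker_one (ε := ε)).sum_eq_one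
      simpa only [hg] using this
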